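/- Let $d\ge 3$. For an open set $V\subset\mathbb R^d$, let $H^{-1}(V)$ and $W^{-1,\infty}(V)$ be the dual spaces of $H^1_0(V)$ and $W^{1,1}_0(V)$. Let $H^{-1}_{\rm loc}(\mathbb R^d)^+$ (resp. $W^{-1,\infty}_{\rm loc}(\mathbb R^d)^+$) be the set of nonnegative Borel measures on $\mathbb R^d$, finite on compact sets, which belong to $H^{-1}(V)$ (resp. $W^{-1,\infty}(V)$) for every ball $V$; we say that $\nu^\varepsilon\to\nu$ in $H^{-1}_{\rm loc}(\mathbb R^d)$ if $\|\nu^\varepsilon-\nu\|_{H^{-1}(V)}\to0$ for every ball $V$. Let $A\subset\mathbb R^d$ be a bounded Borel set and $\Lambda\subset\mathbb R^d$ a countable set such that the translates $A+i$ $(i\in\Lambda)$ are pairwise disjoint and cover $\mathbb R^d$, and put $A_i^\varepsilon=\varepsilon(A+i)$ for $\varepsilon>0$, $i\in\Lambda$. A $C^1$ hypersurface is a set $M\subset\mathbb R^d$ which near each of its points is the zero set of a $C^1$ function with nonvanishing gradient. A piecewise $C^1$ surface is the union $S=\bigcup_j P_j$ of a locally finite countable family of Borel sets $P_j$, each satisfying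 $M_j\cap O_j\subset P_j\subset\overline{M_j\cap O_j}$ for some $C^1$ hypersurface $M_j$ and some open set $O_j$ such that $\overline{M_j\cap O_j}$ is compact and contained in $M_j$. Its surface measure $\delta_S$ is the $(d-1)$-dimensional Hausdorff measure (normalized to agree with Lebesgue measure on $\mathbb R^{d-1}$) restricted to $S$. Let $S$ be a piecewise $C^1$ surface in $\mathbb R^d$ and $\mu=\delta_S$. Then $\mu\in W^{-1,\infty}_{\rm loc}(\mathbb R^d)^+$, and there are measures $\nu^\varepsilon\in H^{-1}_{\rm loc}(\mathbb R^d)^+$ $(\varepsilon>0)$, converging in $H^{-1}_{\rm loc}(\mathbb R^d)$ as $\varepsilon\to0^+$ to some $\nu\in H^{-1}_{\rm loc}(\mathbb R^d)^+$, such that for all sufficiently small $\varepsilon>0$ $$\sum_{i\in\Lambda}\frac{\mu(A_i^\varepsilon)}{|A_i^\varepsilon|}\,1_{A_i^\varepsilon}\le\nu^\varepsilon$$ in the sense of measures, the left-hand side being the density of a measure with respect to Lebesgue measure. -/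

import Mathlib

open Set Filter Topology MeasureTheory TopologicalSpace
open scoped ENNReal Pointwise

/-- Euclidean space `ℝ^d`. -/
abbrev RSpace (d : ℕ) := EuclideanSpace ℝ (Fin d)

/-! ### Piecewise `C¹` surfaces and surface measure -/

/-- `M ⊆ ℝ^d` is an (embedded) `C¹` hypersurface: near each of its points it is the zero set of a
`C¹` function with nonvanishing gradient. No boundary, and not necessarily closed in `ℝ^d`. -/
def IsC1Hypersurface {d : ℕ} (M : Set (RSpace d)) : Prop :=
  ∀ x ∈ M, ∃ (U : Set (RSpace d)) (φ : RSpace d → ℝ), IsOpen U ∧ x ∈ U ∧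
    ContDiffOn ℝ 1 φ U ∧ (∀ y ∈ U, fderiv ℝ φ y ≠ 0) ∧ M ∩ U = {y ∈ U | φ y = 0}

/-- `P` is a `C¹` surface piece: it is a relatively open part `M ∩ O` of a `C¹` hypersurface `M`,
together with any (Borel) part of its boundary; the closure is compact and still lies in `M`
(so the piece is `C¹` up to its boundary). -/
def IsC1Piece {d : ℕ} (P : Set (RSpace d)) : Prop :=
  ∃ M O : Set (RSpace d), IsC1Hypersurface M ∧ IsOpen O ∧
    IsCompact (closure (M ∩ O)) ∧ closure (M ∩ O) ⊆ M ∧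
    MeasurableSet P ∧ M ∩ O ⊆ P ∧ P ⊆ closure (M ∩ O)

/-- `S` is a piecewise `C¹` surface: the union of a locally finite family of `C¹` surface pieces.
Pieces may be empty, so that finite families are included; a bounded surface
consists of finitely many pieces. -/
def IsPiecewiseC1Surface {d : ℕ} (S : Set (RSpace d)) : Prop :=
  ∃ P : ℕ → Set (RSpace d), (∀ j, IsC1Piece (P j)) ∧ LocallyFinite P ∧ S = ⋃ j, P j

/-- The surface measure `δ_S`: the `(d-1)`-dimensional Hausdorff measure, normalized to agree with
Lebesgue measure on `ℝ^(d-1)`, restricted to `S`. -/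
noncomputable def surfaceMeasure {d : ℕ} (S : Set (RSpace d)) : Measure (RSpace d) :=
  (Measure.euclideanHausdorffMeasure (d - 1)).restrict S

/-! ### Negative Sobolev spaces, as duals of `H¹₀(V)` and `W^{1,1}_0(V)`

Since test functions are dense in `H¹₀(V)` and in `W^{1,1}_0(V)`, the dual norms are computed on test
functions. -/

/-- The norm of `H¹₀`, on test functions. -/
noncomputable def h1Norm {d : ℕ} {V : Opens (RSpace d)} (g : TestFunction V ℝ ⊤) : ℝ :=
  Real.sqrt ((∫ x, (g x) ^ 2) + ∫ x, ‖fderiv ℝ g x‖ ^ 2)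

/-- The norm of `W^{1,1}_0`, on test functions. -/
noncomputable def w11Norm {d : ℕ} {V : Opens (RSpace d)} (g : TestFunction V ℝ ⊤) : ℝ :=
  (∫ x, |g x|) + ∫ x, ‖fderiv ℝ g x‖

/-- The norm of `H^{-1}(V) = H¹₀(V)*` (`∞` for a functional which is not in `H^{-1}(V)`). -/
noncomputable def hNegOneNorm {d : ℕ} {V : Opens (RSpace d)} (T : TestFunction V ℝ ⊤ → ℝ) : ℝ≥0∞ :=
  ⨆ (g : TestFunction V ℝ ⊤) (_ : h1Norm g ≤ 1), ENNReal.ofReal |T g|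

/-- The norm of `W^{-1,∞}(V) = W^{1,1}_0(V)*`. -/
noncomputable def wNegOneInftyNorm {d : ℕ} {V : Opens (RSpace d)}
    (T : TestFunction V ℝ ⊤ → ℝ) : ℝ≥0∞ :=
  ⨆ (g : TestFunction V ℝ ⊤) (_ : w11Norm g ≤ 1), ENNReal.ofReal |T g|

/-- The distribution `g ↦ ∫ g dμ` on `V` given by a Borel measure `μ` (finite on compact sets). -/
noncomputable def measurePairing {d : ℕ} (μ : Measure (RSpace d)) (V : Opens (RSpace d))
    (g : TestFunction V ℝ ⊤) : ℝ :=
  ∫ x, g x ∂μ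

/-- The open ball `B(c, r)` as an open set. -/
def openBall {d : ℕ} (c : RSpace d) (r : ℝ) : Opens (RSpace d) :=
  ⟨Metric.ball c r, Metric.isOpen_ball⟩

/-- `μ ∈ H^{-1}_loc(ℝ^d)⁺`: a nonnegative Borel measure, finite on compact sets (so that it is a
distribution), which belongs to `H^{-1}(V)` for every ball `V`. -/
def MemHNegOneLocPos {d : ℕ} (μ : Measure (RSpace d)) : Prop :=
  IsLocallyFiniteMeasure μ ∧
    ∀ (c : RSpace d) (r : ℝ), hNegOneNorm (measurePairing μ (openBall c r)) < ∞

/-- `μ ∈ W^{-1,∞}_loc(ℝ^d)⁺`. -/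
def MemWNegOneInftyLocPos {d : ℕ} (μ : Measure (RSpace d)) : Prop :=
  IsLocallyFiniteMeasure μ ∧
    ∀ (c : RSpace d) (r : ℝ), wNegOneInftyNorm (measurePairing μ (openBall c r)) < ∞

/-- `ν^ε → ν₀` in `H^{-1}_loc(ℝ^d)` as `ε → 0+`. -/
def TendstoHNegOneLoc {d : ℕ} (ν : ℝ → Measure (RSpace d)) (ν₀ : Measure (RSpace d)) : Prop :=
  ∀ (c : RSpace d) (r : ℝ),
    Tendsto (fun ε : ℝ => hNegOneNorm
        (fun g => measurePairing (ν ε) (openBall c r) g - measurePairing ν₀ (openBall c r) g))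
      (𝓝[>] 0) (𝓝 0)

/-! ### Tiles and the admissibility assumption -/

/-- `A` is a bounded Borel set and the translates `A + i`, `i ∈ Λ` (`Λ` countable), partition `ℝ^d`. -/
structure IsTiling {d : ℕ} (A Λ : Set (RSpace d)) : Prop where
  isBounded : Bornology.IsBounded A
  measurableSet : MeasurableSet A
  countable : Λ.Countable
  cover : ⋃ i ∈ Λ, (i +ᵥ A) = univ
  disjoint : Λ.PairwiseDisjoint (fun i => i +ᵥ A)

/-- The scaled tile `A_i^ε = ε (A + i)`. -/
def scaledTile {d : ℕ} (A : Set (RSpace d)) (ε : ℝ) (i : RSpace d) : Set (RSpace d) :=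
  ε • (i +ᵥ A)

/-- The tile averages `∑_i (μ(A_i^ε) / |A_i^ε|) 1_{A_i^ε}` of `μ`, as a function. -/
noncomputable def tileAverage {d : ℕ} (A Λ : Set (RSpace d)) (μ : Measure (RSpace d)) (ε : ℝ)
    (x : RSpace d) : ℝ≥0∞ :=
  ∑' i : Λ, (scaledTile A ε i).indicator
    (fun _ => μ (scaledTile A ε i) / volume (scaledTile A ε i)) x

/-- The admissibility assumption on the potential `μ` with respect to the tiles given by `A`, `Λ`:
`μ ∈ W^{-1,∞}_loc(ℝ^d)⁺`, and there is a family `ν^ε` in `H^{-1}_loc(ℝ^d)⁺`, converging in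
`H^{-1}_loc(ℝ^d)`, which dominates the tile averages of `μ` (as measures) for all small `ε > 0`. -/
def IsAdmissible {d : ℕ} (A Λ : Set (RSpace d)) (μ : Measure (RSpace d)) : Prop :=
  MemWNegOneInftyLocPos μ ∧
    ∃ (ν : ℝ → Measure (RSpace d)) (ν₀ : Measure (RSpace d)),
      (∀ ε : ℝ, 0 < ε → MemHNegOneLocPos (ν ε)) ∧ MemHNegOneLocPos ν₀ ∧
      TendstoHNegOneLoc ν ν₀ ∧
      ∀ᶠ ε : ℝ in 𝓝[>] 0, volume.withDensity (tileAverage A Λ μ ε) ≤ ν ε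

/-! Write d = n + 1. Near each point a `C¹` hypersurface lies in a Lipschitz graph over a coordinate
hyperplane (`IsC1Hypersurface.exists_graphPatch`). Hence `δ_S` is at most a constant times a locally
finite sum of Lebesgue measures of cubes lifted to such graphs (`surfaceMeasure_le_sum`), and it
suffices to work with one graph. Integrating the gradient along vertical lines bounds the `L¹` trace
on a graph by the `W^{1,1}` norm, which gives `μ ∈ W^{-1,∞}_loc`.

A tile of size ε that meets a graph carries lifted mass `O(ε^n)`, has volume of order `ε^(n+1)`, and
stays within vertical distance `O(ε)` of the graph. The tile averages are therefore at most a
density `a / δ` on the tube of half-height δ, with δ proportional to ε and `a` fixed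
(`IsTiling.withDensity_tileAverage_le`). These uniform tube measures are the `ν^ε`.

Vertical projection pushes the tube measure onto a multiple of the lifted measure that does not
depend on δ; this is the limit `ν`. The difference of the two pairings is the integral of `g - g ∘
proj` over the tube, at most `2a ∫_tube |∇g|`, and Cauchy–Schwarz on a tube of volume `O(δ)` makes
it `O(√δ)` uniformly for `h1Norm g ≤ 1` (`GraphPatch.enorm_measurePairing_sub_le`). -/

/-! ### Coordinates with one distinguished direction -/

/-- The point of `ℝ^(n+1)` whose `i`-th coordinate is `t` and whose other coordinates are `y`. -/
def insertCoord {n : ℕ} (i : Fin (n + 1)) (t : ℝ) (y : Fin n → ℝ) : RSpace (n + 1) :=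
  WithLp.toLp 2 (i.insertNth t y)

/-- The coordinates of a point of `ℝ^(n+1)` other than the `i`-th one. -/
def removeCoord {n : ℕ} (i : Fin (n + 1)) (x : RSpace (n + 1)) : Fin n → ℝ :=
  fun j => x (i.succAbove j)

section Coordinates

variable {n : ℕ} (i : Fin (n + 1))

@[simp] theorem insertCoord_apply_same (t : ℝ) (y : Fin n → ℝ) : insertCoord i t y i = t := by
  simp [insertCoord]

@[simp] theorem removeCoord_insertCoord (t : ℝ) (y : Fin n → ℝ) :
    removeCoord i (insertCoord i t y) = y := by
  ext j; simp [insertCoord, removeCoord]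

@[simp] theorem insertCoord_removeCoord (x : RSpace (n + 1)) :
    insertCoord i (x i) (removeCoord i x) = x := by
  ext j
  rcases Fin.eq_self_or_eq_succAbove i j with rfl | ⟨k, rfl⟩ <;> simp [insertCoord, removeCoord]

theorem insertCoord_eq_add (t : ℝ) (y : Fin n → ℝ) :
    insertCoord i t y = insertCoord i 0 y + t • EuclideanSpace.single i (1 : ℝ) := by
  ext j
  rcases Fin.eq_self_or_eq_succAbove i j with rfl | ⟨k, rfl⟩ <;> simp [insertCoord]

@[fun_prop] theorem continuous_insertCoord :
    Continuous fun z : ℝ × (Fin n → ℝ) => insertCoord i z.1 z.2 :=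
  (PiLp.continuous_toLp 2 fun _ : Fin (n + 1) => ℝ).comp
    (Continuous.finInsertNth (A := fun _ => ℝ) i continuous_fst continuous_snd)

@[fun_prop] theorem continuous_removeCoord : Continuous (removeCoord (n := n) i) := by
  unfold removeCoord; fun_prop

theorem dist_removeCoord_le (x y : RSpace (n + 1)) :
    dist (removeCoord i x) (removeCoord i y) ≤ dist x y := by
  refine (dist_pi_le_iff dist_nonneg).2 fun j => ?_
  have := PiLp.norm_apply_le (x - y) (i.succAbove j)
  simpa [removeCoord, dist_eq_norm] using this

theorem abs_apply_sub_le_dist (x y : RSpace (n + 1)) (j : Fin (n + 1)) :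
    |x j - y j| ≤ dist x y := by
  simpa [dist_eq_norm] using PiLp.norm_apply_le (x - y) j

theorem measurePreserving_insertCoord :
    MeasurePreserving fun z : ℝ × (Fin n → ℝ) => insertCoord i z.1 z.2 :=
  (PiLp.volume_preserving_toLp (Fin (n + 1))).comp
    (volume_preserving_piFinSuccAbove (fun _ : Fin (n + 1) => ℝ) i).symm

theorem lintegral_eq_lintegral_insertCoord {f : RSpace (n + 1) → ℝ≥0∞} (hf : Measurable f) :
    ∫⁻ x, f x = ∫⁻ y : Fin n → ℝ, ∫⁻ t : ℝ, f (insertCoord i t y) := by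
  rw [← (measurePreserving_insertCoord i).lintegral_comp hf]
  exact lintegral_prod_symm' _ (hf.comp (continuous_insertCoord i).measurable)

/-- The constant by which distances in `ℝ^N` and in the sup norm are compared. -/
noncomputable def euclideanConst (N : ℕ) : NNReal :=
  (Fintype.card (Fin N) : NNReal) ^ (1 / (2 : ℝ≥0∞)).toReal

theorem dist_insertCoord_le (s t : ℝ) (y z : Fin n → ℝ) :
    dist (insertCoord i s y) (insertCoord i t z) ≤
      euclideanConst (n + 1) * max |s - t| (dist y z) := by
  refine ((PiLp.lipschitzWith_toLp 2 fun _ : Fin (n + 1) => ℝ).dist_le_mul _ _).trans ?_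
  refine mul_le_mul_of_nonneg_left ?_ (NNReal.coe_nonneg _)
  refine (dist_pi_le_iff (by positivity)).2 fun j => ?_
  rcases Fin.eq_self_or_eq_succAbove i j with rfl | ⟨k, rfl⟩
  · simp [Real.dist_eq]
  · simpa using Or.inr (dist_le_pi_dist y z k)

end Coordinates

/-! ### Estimates along lines -/

section Lines

variable {n : ℕ} (i : Fin (n + 1)) {g : RSpace (n + 1) → ℝ}

theorem hasDerivAt_comp_insertCoord (hg : ContDiff ℝ 1 g) (y : Fin n → ℝ) (t : ℝ) :
    HasDerivAt (fun t => g (insertCoord i t y))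
      (fderiv ℝ g (insertCoord i t y) (EuclideanSpace.single i (1 : ℝ))) t := by
  have h1 : HasDerivAt (fun t => insertCoord i t y) (EuclideanSpace.single i (1 : ℝ)) t := by
    rw [funext fun t => insertCoord_eq_add i t y]
    simpa using ((hasDerivAt_id t).smul_const (EuclideanSpace.single i (1 : ℝ))).const_add
      (insertCoord i 0 y)
  exact ((hg.differentiable one_ne_zero _).hasFDerivAt).comp_hasDerivAt t h1

theorem contDiff_comp_insertCoord (hg : ContDiff ℝ 1 g) (y : Fin n → ℝ) :
    ContDiff ℝ 1 fun t => g (insertCoord i t y) := by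
  refine hg.comp ?_
  rw [funext fun t => insertCoord_eq_add i t y]
  fun_prop

theorem enorm_deriv_comp_insertCoord_le (hg : ContDiff ℝ 1 g) (y : Fin n → ℝ) (t : ℝ) :
    ‖deriv (fun t => g (insertCoord i t y)) t‖ₑ ≤ ‖fderiv ℝ g (insertCoord i t y)‖ₑ := by
  rw [(hasDerivAt_comp_insertCoord i hg y t).deriv]
  have := (fderiv ℝ g (insertCoord i t y)).le_opNorm (EuclideanSpace.single i (1 : ℝ))
  simp only [PiLp.norm_single, norm_one, mul_one] at this
  exact enorm_le_iff_norm_le.2 this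

theorem enorm_le_lintegral_line (hg : ContDiff ℝ 1 g) (hc : HasCompactSupport g)
    (y : Fin n → ℝ) (t : ℝ) :
    ‖g (insertCoord i t y)‖ₑ ≤ ∫⁻ s : ℝ, ‖fderiv ℝ g (insertCoord i s y)‖ₑ := by
  -- A vertical line is a closed embedding, so compact support survives restriction to it and the
  -- fundamental theorem of calculus has no boundary term at infinity.
  have hc' : HasCompactSupport fun t => g (insertCoord i t y) := by
    have hemb : IsClosedEmbedding fun t => insertCoord i t y := by
      refine Function.LeftInverse.isClosedEmbedding (f := fun x : RSpace (n + 1) => x i) ?_ ?_ ?_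
      · intro t; simp
      · fun_prop
      · exact (continuous_insertCoord i).comp (by fun_prop : Continuous fun t : ℝ => (t, y))
    exact hc.comp_isClosedEmbedding hemb
  refine (hc'.enorm_le_lintegral_Ici_deriv (contDiff_comp_insertCoord i hg y) t).trans ?_
  refine (setLIntegral_le_lintegral _ _).trans ?_
  exact lintegral_mono fun s => enorm_deriv_comp_insertCoord_le i hg y s

theorem enorm_sub_le_lintegral_line (hg : ContDiff ℝ 1 g) (y : Fin n → ℝ) {a b s t : ℝ}
    (hs : s ∈ Icc a b) (ht : t ∈ Icc a b) :
    ‖g (insertCoord i t y) - g (insertCoord i s y)‖ₑ ≤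
      ∫⁻ r in Icc a b, ‖fderiv ℝ g (insertCoord i r y)‖ₑ := by
  have hd := contDiff_comp_insertCoord i hg y
  have h := intervalIntegral.integral_eq_sub_of_hasDerivAt (a := s) (b := t)
    (f := fun t => g (insertCoord i t y)) (f' := deriv fun t => g (insertCoord i t y))
    (fun r _ => (hd.differentiable one_ne_zero r).hasDerivAt)
    ((hd.continuous_deriv le_rfl).intervalIntegrable _ _)
  rw [← h]
  have h2 : ‖∫ r in s..t, deriv (fun t => g (insertCoord i t y)) r‖ₑ =
      ‖∫ r in uIoc s t, deriv (fun t => g (insertCoord i t y)) r‖ₑ := by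
    rw [← ofReal_norm, ← ofReal_norm, intervalIntegral.norm_intervalIntegral_eq]
  rw [h2]
  refine (enorm_integral_le_lintegral_enorm _).trans ?_
  refine (lintegral_mono fun r => enorm_deriv_comp_insertCoord_le i hg y r).trans ?_
  refine lintegral_mono_set ?_
  exact uIoc_subset_uIcc.trans (uIcc_subset_Icc hs ht)

end Lines

/-! ### Lipschitz graph patches over coordinate hyperplanes -/

/-- A Lipschitz function over a coordinate hyperplane of `ℝ^(n+1)`, with a centre in it. -/
structure GraphPatch (n : ℕ) where
  /-- the vertical direction -/
  dir : Fin (n + 1)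
  /-- the function whose graph is considered -/
  height : (Fin n → ℝ) → ℝ
  /-- the centre of the patch, in the hyperplane -/
  center : Fin n → ℝ
  lipschitz : LipschitzWith (2 * n + 1) height

namespace GraphPatch

variable {n : ℕ} (p : GraphPatch n)

/-- The parametrization of the graph. -/
def param (y : Fin n → ℝ) : RSpace (n + 1) := insertCoord p.dir (p.height y) y

/-- The centre of the patch, on the graph. -/
def base : RSpace (n + 1) := p.param p.center

/-- The Lebesgue measure of a cube of the hyperplane, lifted to the graph. -/
noncomputable def liftedMeasure (r : ℝ) : Measure (RSpace (n + 1)) :=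
  (volume.restrict (Metric.closedBall p.center r)).map p.param

/-- The points at vertical distance at most `δ` from the graph. -/
def tube (δ : ℝ) : Set (RSpace (n + 1)) :=
  {x | removeCoord p.dir x ∈ Metric.closedBall p.center 2 ∧
    |x p.dir - p.height (removeCoord p.dir x)| ≤ δ}

/-- The vertical projection to the graph. -/
def proj (x : RSpace (n + 1)) : RSpace (n + 1) := p.param (removeCoord p.dir x)

@[fun_prop] theorem continuous_height : Continuous p.height := p.lipschitz.continuous

@[fun_prop] theorem continuous_param : Continuous p.param :=
  (continuous_insertCoord p.dir).comp (by fun_prop : Continuous fun y => (p.height y, y))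

@[fun_prop] theorem continuous_proj : Continuous p.proj :=
  p.continuous_param.comp (continuous_removeCoord _)

theorem isClosed_tube (δ : ℝ) : IsClosed (p.tube δ) := by
  refine IsClosed.inter ?_ ?_
  · exact Metric.isClosed_closedBall.preimage (continuous_removeCoord _)
  · have hf : Continuous fun x => |x p.dir - p.height (removeCoord p.dir x)| := by fun_prop
    exact isClosed_le hf continuous_const

theorem abs_height_sub_le (y z : Fin n → ℝ) :
    |p.height y - p.height z| ≤ (2 * n + 1) * dist y z := by
  simpa [Real.dist_eq] using p.lipschitz.dist_le_mul y z

theorem lipschitzWith_param : LipschitzWith (euclideanConst (n + 1) * (2 * n + 1)) p.param := by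
  refine LipschitzWith.of_dist_le_mul fun y z => ?_
  refine (dist_insertCoord_le _ _ _ _ _).trans ?_
  rw [NNReal.coe_mul, mul_assoc]
  refine mul_le_mul_of_nonneg_left (max_le ?_ ?_) (NNReal.coe_nonneg _)
  · simpa using p.abs_height_sub_le y z
  · push_cast
    nlinarith [dist_nonneg (x := y) (y := z), (Nat.cast_nonneg n : (0 : ℝ) ≤ n)]

/-- A radius within which the patch and its tubes stay. -/
noncomputable def radius (n : ℕ) : ℝ := euclideanConst (n + 1) * (2 * (2 * n + 1) + 1)

theorem param_mem_closedBall {y : Fin n → ℝ} (hy : y ∈ Metric.closedBall p.center 2) :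
    p.param y ∈ Metric.closedBall p.base (radius n) := by
  rw [Metric.mem_closedBall] at hy ⊢
  refine (p.lipschitzWith_param.dist_le_mul _ _).trans ?_
  rw [NNReal.coe_mul, mul_assoc, radius]
  refine mul_le_mul_of_nonneg_left ?_ (NNReal.coe_nonneg _)
  push_cast
  nlinarith [(Nat.cast_nonneg n : (0 : ℝ) ≤ n)]

theorem tube_subset_closedBall {δ : ℝ} (hδ : δ ≤ 1) :
    p.tube δ ⊆ Metric.closedBall p.base (radius n) := by
  rintro x ⟨hx, hx'⟩
  rw [Metric.mem_closedBall] at hx ⊢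
  nth_rewrite 1 [← insertCoord_removeCoord p.dir x]
  refine (dist_insertCoord_le _ _ _ _ _).trans ?_
  refine mul_le_mul_of_nonneg_left (max_le ?_ ?_) (NNReal.coe_nonneg _)
  · have := p.abs_height_sub_le (removeCoord p.dir x) p.center
    have h3 := abs_sub_le (x p.dir) (p.height (removeCoord p.dir x)) (p.height p.center)
    nlinarith [(Nat.cast_nonneg n : (0 : ℝ) ≤ n)]
  · nlinarith [(Nat.cast_nonneg n : (0 : ℝ) ≤ n)]

theorem liftedMeasure_apply (r : ℝ) {B : Set (RSpace (n + 1))} (hB : MeasurableSet B) :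
    p.liftedMeasure r B = volume (p.param ⁻¹' B ∩ Metric.closedBall p.center r) := by
  rw [liftedMeasure, Measure.map_apply p.continuous_param.measurable hB,
    Measure.restrict_apply (p.continuous_param.measurable hB)]

theorem lintegral_liftedMeasure (r : ℝ) {f : RSpace (n + 1) → ℝ≥0∞} (hf : Measurable f) :
    ∫⁻ x, f x ∂p.liftedMeasure r =
      ∫⁻ y in Metric.closedBall p.center r, f (p.param y) :=
  lintegral_map hf p.continuous_param.measurable

theorem liftedMeasure_compl_closedBall {r : ℝ} (hr : r ≤ 2) :
    p.liftedMeasure r (Metric.closedBall p.base (radius n))ᶜ = 0 := by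
  rw [p.liftedMeasure_apply r Metric.isClosed_closedBall.measurableSet.compl]
  convert measure_empty (μ := volume)
  refine eq_empty_of_forall_notMem fun y hy => hy.1 (p.param_mem_closedBall ?_)
  exact Metric.closedBall_subset_closedBall hr hy.2

instance (r : ℝ) : IsFiniteMeasure (p.liftedMeasure r) := by
  have : IsFiniteMeasure (volume.restrict (Metric.closedBall p.center r)) :=
    isFiniteMeasure_restrict.2 (measure_closedBall_lt_top).ne
  unfold liftedMeasure; infer_instance

/-- The trace inequality on a patch. -/
theorem lintegral_enorm_liftedMeasure_le (r : ℝ) {g : RSpace (n + 1) → ℝ} (hg : ContDiff ℝ 1 g)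
    (hc : HasCompactSupport g) :
    ∫⁻ x, ‖g x‖ₑ ∂p.liftedMeasure r ≤ ∫⁻ x, ‖fderiv ℝ g x‖ₑ := by
  have hm := (hg.continuous_fderiv one_ne_zero).measurable.enorm
  rw [p.lintegral_liftedMeasure r hg.continuous.measurable.enorm,
    lintegral_eq_lintegral_insertCoord p.dir hm]
  refine (setLIntegral_le_lintegral _ _).trans (lintegral_mono fun y => ?_)
  exact enorm_le_lintegral_line p.dir hg hc y _

theorem lintegral_tube (δ : ℝ) {f : RSpace (n + 1) → ℝ≥0∞} (hf : Measurable f) :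
    ∫⁻ x in p.tube δ, f x = ∫⁻ y in Metric.closedBall p.center 2,
      ∫⁻ t in Icc (p.height y - δ) (p.height y + δ), f (insertCoord p.dir t y) := by
  have hm := (p.isClosed_tube δ).measurableSet
  rw [← lintegral_indicator hm, lintegral_eq_lintegral_insertCoord p.dir (hf.indicator hm),
    ← lintegral_indicator Metric.isClosed_closedBall.measurableSet]
  refine lintegral_congr fun y => ?_
  by_cases hy : y ∈ Metric.closedBall p.center 2
  · rw [indicator_of_mem hy, ← lintegral_indicator measurableSet_Icc]
    refine lintegral_congr fun t => ?_
    have : insertCoord p.dir t y ∈ p.tube δ ↔ t ∈ Icc (p.height y - δ) (p.height y + δ) := by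
      simp only [tube, mem_ofPred_eq, removeCoord_insertCoord, hy, true_and,
        insertCoord_apply_same, mem_Icc, abs_le]
      constructor <;> rintro ⟨h1, h2⟩ <;> constructor <;> linarith
    simp only [indicator, this]
  · rw [indicator_of_notMem hy]
    convert lintegral_zero with t
    refine indicator_of_notMem (fun h => hy ?_) _
    simpa [tube] using h.1

/-- `f ∘ proj` is constant on each vertical fibre of the tube, and every fibre has length 2δ. -/
theorem lintegral_tube_proj (δ : ℝ) {f : RSpace (n + 1) → ℝ≥0∞} (hf : Measurable f) :
    ∫⁻ x in p.tube δ, f (p.proj x) =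
      ENNReal.ofReal (2 * δ) * ∫⁻ x, f x ∂p.liftedMeasure 2 := by
  rw [p.lintegral_tube δ (f := fun x => f (p.proj x)) (hf.comp p.continuous_proj.measurable),
    p.lintegral_liftedMeasure 2 hf,
    ← lintegral_const_mul (f := fun y => f (p.param y)) _
      (hf.comp p.continuous_param.measurable)]
  refine lintegral_congr fun y => ?_
  simp only [proj, removeCoord_insertCoord, lintegral_const, Measure.restrict_apply_univ,
    Real.volume_Icc]
  rw [mul_comm]; congr 2; ring

theorem map_proj_restrict_tube (δ : ℝ) :
    (volume.restrict (p.tube δ)).map p.proj = ENNReal.ofReal (2 * δ) • p.liftedMeasure 2 := by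
  ext B hB
  have h := p.lintegral_tube_proj δ (f := B.indicator 1) (measurable_one.indicator hB)
  rw [lintegral_indicator_one hB] at h
  rw [Measure.smul_apply, smul_eq_mul, ← h, ← lintegral_indicator_one hB,
    lintegral_map (measurable_one.indicator hB) p.continuous_proj.measurable]

theorem liftedMeasure_univ_le : p.liftedMeasure 2 univ ≤ 4 ^ n := by
  rw [p.liftedMeasure_apply 2 MeasurableSet.univ, preimage_univ, univ_inter,
    Real.volume_pi_closedBall _ (by norm_num)]
  norm_num

theorem volume_tube_le (δ : ℝ) : volume (p.tube δ) ≤ ENNReal.ofReal (2 * δ) * 4 ^ n := by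
  have h := congrArg (fun m => m univ) (p.map_proj_restrict_tube δ)
  simp only [Measure.map_apply p.continuous_proj.measurable MeasurableSet.univ, preimage_univ,
    Measure.restrict_apply_univ, Measure.smul_apply, smul_eq_mul] at h
  rw [h]
  gcongr
  exact p.liftedMeasure_univ_le

instance (δ : ℝ) : IsFiniteMeasure (volume.restrict (p.tube δ)) :=
  isFiniteMeasure_restrict.2
    ((p.volume_tube_le δ).trans_lt (ENNReal.mul_lt_top ENNReal.ofReal_lt_top (by simp))).ne

/-- A function on a tube is close to its trace on the graph. -/
theorem lintegral_enorm_sub_proj_le (δ : ℝ) {g : RSpace (n + 1) → ℝ} (hg : ContDiff ℝ 1 g) :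
    ∫⁻ x in p.tube δ, ‖g x - g (p.proj x)‖ₑ ≤
      ENNReal.ofReal (2 * δ) * ∫⁻ x in p.tube δ, ‖fderiv ℝ g x‖ₑ := by
  have hm := (hg.continuous_fderiv one_ne_zero).measurable.enorm
  have hgm := hg.continuous
  -- The interval of integration moves with `y`; writing it as an indicator on the product makes the
  -- inner integral measurable.
  have hm2 : Measurable fun y => ∫⁻ t in Icc (p.height y - δ) (p.height y + δ),
      ‖fderiv ℝ g (insertCoord p.dir t y)‖ₑ := by
    have h1 : Measurable fun z : (Fin n → ℝ) × ℝ =>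
        {z : (Fin n → ℝ) × ℝ | z.2 ∈ Icc (p.height z.1 - δ) (p.height z.1 + δ)}.indicator
          (fun z => ‖fderiv ℝ g (insertCoord p.dir z.2 z.1)‖ₑ) z := by
      refine Measurable.indicator ?_ ?_
      · exact hm.comp ((continuous_insertCoord p.dir).measurable.comp measurable_swap)
      · have ha : Continuous fun z : (Fin n → ℝ) × ℝ => p.height z.1 - δ := by fun_prop
        have hb : Continuous fun z : (Fin n → ℝ) × ℝ => p.height z.1 + δ := by fun_prop
        exact ((isClosed_le ha continuous_snd).inter
          (isClosed_le continuous_snd hb)).measurableSet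
    convert Measurable.lintegral_prod_right' (ν := volume) h1 using 2 with y
    rw [← lintegral_indicator measurableSet_Icc]
    rfl
  rw [p.lintegral_tube δ (by fun_prop), p.lintegral_tube δ hm, ← lintegral_const_mul _ hm2]
  refine setLIntegral_mono (by fun_prop) fun y _ => ?_
  calc ∫⁻ t in Icc (p.height y - δ) (p.height y + δ),
        ‖g (insertCoord p.dir t y) - g (p.proj (insertCoord p.dir t y))‖ₑ
      ≤ ∫⁻ _ in Icc (p.height y - δ) (p.height y + δ),
          ∫⁻ r in Icc (p.height y - δ) (p.height y + δ),
            ‖fderiv ℝ g (insertCoord p.dir r y)‖ₑ := by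
        refine setLIntegral_mono measurable_const fun t ht => ?_
        simp only [proj, removeCoord_insertCoord, param]
        refine enorm_sub_le_lintegral_line p.dir hg y ?_ ht
        constructor <;> linarith [ht.1, ht.2]
    _ = _ := by
        rw [lintegral_const, Measure.restrict_apply_univ, Real.volume_Icc, mul_comm]
        congr 2; ring

/-- The Hausdorff measure of a piece of the graph is controlled by its vertical projection. -/
theorem euclideanHausdorffMeasure_inter_image_le (r : ℝ) {B : Set (RSpace (n + 1))}
    (hB : MeasurableSet B) :
    Measure.euclideanHausdorffMeasure n (B ∩ p.param '' Metric.closedBall p.center r) ≤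
      (Measure.addHaarScalarFactor (volume : Measure (EuclideanSpace ℝ (Fin n)))
        (Measure.hausdorffMeasure n) * (euclideanConst (n + 1) * (2 * n + 1)) ^ n : NNReal) *
        p.liftedMeasure r B := by
  have hsub : B ∩ p.param '' Metric.closedBall p.center r =
      p.param '' (p.param ⁻¹' B ∩ Metric.closedBall p.center r) := by
    rw [image_preimage_inter]
  -- A Lipschitz image enlarges Hausdorff measure by at most the n-th power of the constant, and for
  -- the sup norm on `Fin n → ℝ` Hausdorff measure is Lebesgue measure. The Haar factor accounts for
  -- the Euclidean normalization.
  have h := p.lipschitzWith_param.hausdorffMeasure_image_le (d := n) n.cast_nonneg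
    (p.param ⁻¹' B ∩ Metric.closedBall p.center r)
  have h2 := hausdorffMeasure_pi_real (ι := Fin n)
  rw [Fintype.card_fin] at h2
  rw [h2, ENNReal.rpow_natCast] at h
  rw [p.liftedMeasure_apply r hB, Measure.euclideanHausdorffMeasure_def, hsub,
    Measure.smul_apply, ENNReal.smul_def, smul_eq_mul, ENNReal.coe_mul, mul_assoc]
  gcongr
  simpa using h

end GraphPatch

/-! ### Covering a piecewise `C¹` surface by graph patches -/

section Cover

variable {n : ℕ}

theorem sum_smul_single_eq (w : RSpace (n + 1)) :
    ∑ j, w j • EuclideanSpace.single j (1 : ℝ) = w := by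
  simpa using (EuclideanSpace.basisFun (Fin (n + 1)) ℝ).sum_repr w

/-- The cone condition for increments on which a linear form is almost zero. -/
theorem abs_apply_le_of_abs_linear_le (D : RSpace (n + 1) →L[ℝ] ℝ) (i : Fin (n + 1))
    (hi : ∀ j, |D (EuclideanSpace.single j 1)| ≤ |D (EuclideanSpace.single i 1)|)
    (h0 : D (EuclideanSpace.single i 1) ≠ 0) {w : RSpace (n + 1)} {m : ℝ}
    (hm : ∀ j, |w (i.succAbove j)| ≤ m) (hm0 : 0 ≤ m)
    (hw : |D w| ≤ |D (EuclideanSpace.single i 1)| / (2 * (n + 1)) * ‖w‖) :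
    |w i| ≤ (2 * n + 1) * m := by
  set a := fun j => D (EuclideanSpace.single j (1 : ℝ)) with ha
  have hDw : D w = w i * a i + ∑ j, w (i.succAbove j) * a (i.succAbove j) := by
    rw [← Fin.sum_univ_succAbove (fun j => w j * a j) i]
    conv_lhs => rw [← sum_smul_single_eq w]
    simp [ha]
  have hnorm : ‖w‖ ≤ |w i| + n * m := by
    calc ‖w‖ ≤ ∑ j, |w j| := by
          conv_lhs => rw [← sum_smul_single_eq w]
          refine (norm_sum_le _ _).trans (Finset.sum_le_sum fun j _ => ?_)
          simp [norm_smul]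
      _ = |w i| + ∑ j, |w (i.succAbove j)| := Fin.sum_univ_succAbove _ i
      _ ≤ |w i| + ∑ _j : Fin n, m := by gcongr with j; exact hm j
      _ = _ := by simp
  have hsum : |∑ j, w (i.succAbove j) * a (i.succAbove j)| ≤ n * (m * |a i|) := by
    calc _ ≤ ∑ j, |w (i.succAbove j) * a (i.succAbove j)| := Finset.abs_sum_le_sum_abs _ _
      _ ≤ ∑ _j : Fin n, m * |a i| := by
          refine Finset.sum_le_sum fun j _ => ?_
          rw [abs_mul]
          exact mul_le_mul (hm j) (hi _) (abs_nonneg _) hm0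
      _ = _ := by simp
  have hpos : 0 < |a i| := abs_pos.2 h0
  have h1 : |w i| * |a i| ≤ |D w| + n * (m * |a i|) := by
    rw [← abs_mul, eq_sub_of_add_eq hDw.symm]
    exact (abs_sub _ _).trans (by gcongr)
  have hn : (0 : ℝ) < 2 * (n + 1) := by positivity
  -- The factor `1 / (2 * (n + 1))` is chosen so that half of `|w i|` can be absorbed on the left,
  -- leaving the slope `2 * n + 1`.
  have h2 : |D w| ≤ |a i| * ((|w i| + m) / 2) := by
    refine hw.trans ?_
    rw [div_mul_eq_mul_div, mul_div_assoc]
    refine mul_le_mul_of_nonneg_left ?_ hpos.le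
    rw [div_le_iff₀ hn]
    refine hnorm.trans ?_
    nlinarith [mul_nonneg (n.cast_nonneg : (0 : ℝ) ≤ n) (abs_nonneg (w i)),
      mul_nonneg (n.cast_nonneg : (0 : ℝ) ≤ n) hm0]
  have h3 : |a i| * |w i| ≤ |a i| * ((|w i| + m) / 2 + n * m) := by linarith
  have h4 := le_of_mul_le_mul_left h3 hpos
  linarith

theorem exists_single_ne_zero {D : RSpace (n + 1) →L[ℝ] ℝ} (hD : D ≠ 0) :
    ∃ i, D (EuclideanSpace.single i 1) ≠ 0 ∧
      ∀ j, |D (EuclideanSpace.single j 1)| ≤ |D (EuclideanSpace.single i 1)| := by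
  obtain ⟨i, hi⟩ := Finite.exists_max fun j => |D (EuclideanSpace.single j (1 : ℝ))|
  refine ⟨i, fun h => hD ?_, hi⟩
  ext w
  rw [← sum_smul_single_eq w, map_sum]
  refine Finset.sum_eq_zero fun j _ => ?_
  have h2 := hi j
  rw [h, abs_zero] at h2
  rw [map_smul, abs_eq_zero.1 (le_antisymm h2 (abs_nonneg _)), smul_zero]

/-- Near each of its points, a `C¹` hypersurface is contained in a graph patch. -/
theorem IsC1Hypersurface.exists_graphPatch {M : Set (RSpace (n + 1))} (hM : IsC1Hypersurface M)
    {x : RSpace (n + 1)} (hx : x ∈ M) :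
    ∃ (p : GraphPatch n) (r : ℝ), 0 < r ∧ p.base = x ∧
      M ∩ Metric.ball x r ⊆ p.param '' Metric.closedBall p.center 1 := by
  obtain ⟨U, φ, hU, hxU, hφ, hφ', hMU⟩ := hM x hx
  obtain ⟨i, hi0, hi⟩ := exists_single_ne_zero (hφ' x hxU)
  set D := fderiv ℝ φ x
  -- Strict differentiability controls `φ y - φ z` for both points near `x`. On `M` both values
  -- vanish, so `D (y - z)` is small relative to `‖y - z‖`.
  have hstrict : HasStrictFDerivAt φ D x :=
    (hφ.contDiffAt (hU.mem_nhds hxU)).hasStrictFDerivAt one_ne_zero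
  have hη : 0 < |D (EuclideanSpace.single i 1)| / (2 * (n + 1)) := by positivity
  have hev := hstrict.isLittleO.def hη
  rw [nhds_prod_eq] at hev
  obtain ⟨N, hN, hNφ⟩ := Filter.mem_prod_self_iff.1 hev
  obtain ⟨r, hr, hrN⟩ := Metric.mem_nhds_iff.1 (Filter.inter_mem hN (hU.mem_nhds hxU))
  -- Capping the radius at 1 keeps the projection of `B` in the unit cube around the centre.
  set B := M ∩ Metric.ball x (min r 1) with hB
  have hxB : x ∈ B := ⟨hx, Metric.mem_ball_self (by positivity)⟩
  have hBN : ∀ y ∈ B, y ∈ N ∧ φ y = 0 := fun y hy => by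
    have h := hrN (Metric.ball_subset_ball (min_le_left _ _) hy.2)
    have h2 : y ∈ M ∩ U := ⟨hy.1, h.2⟩
    rw [hMU] at h2
    exact ⟨h.1, h2.2⟩
  have hcone : ∀ y ∈ B, ∀ z ∈ B,
      |y i - z i| ≤ (2 * n + 1) * dist (removeCoord i y) (removeCoord i z) := by
    intro y hy z hz
    refine abs_apply_le_of_abs_linear_le D i hi hi0 (w := y - z) (fun j => ?_) dist_nonneg ?_
    · simpa [Real.dist_eq, removeCoord] using
        dist_le_pi_dist (removeCoord i y) (removeCoord i z) j
    · have h := @hNφ (y, z) ⟨(hBN y hy).1, (hBN z hz).1⟩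
      simpa [(hBN y hy).2, (hBN z hz).2, abs_sub_comm (D z)] using h
  -- The cone condition makes the i-th coordinate on `B` a Lipschitz function of the others. A
  -- chosen inverse of the projection defines it, and `extend_real` extends it to the whole
  -- hyperplane.
  have hinv : ∀ y ∈ B, Function.invFunOn (removeCoord i) B (removeCoord i y) ∈ B ∧
      removeCoord i (Function.invFunOn (removeCoord i) B (removeCoord i y)) = removeCoord i y :=
    fun y hy => Function.invFunOn_pos ⟨y, hy, rfl⟩
  have hinv2 : ∀ y ∈ B, Function.invFunOn (removeCoord i) B (removeCoord i y) i = y i := by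
    intro y hy
    have h := hcone _ (hinv y hy).1 y hy
    rw [(hinv y hy).2, dist_self, mul_zero] at h
    exact sub_eq_zero.1 (abs_eq_zero.1 (le_antisymm h (abs_nonneg _)))
  have hlip : LipschitzOnWith (2 * n + 1)
      (fun u => Function.invFunOn (removeCoord i) B u i) (removeCoord i '' B) := by
    refine LipschitzOnWith.of_dist_le_mul ?_
    rintro _ ⟨y, hy, rfl⟩ _ ⟨z, hz, rfl⟩
    rw [hinv2 y hy, hinv2 z hz, Real.dist_eq]
    simpa using hcone y hy z hz
  obtain ⟨h, hh, hheq⟩ := hlip.extend_real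
  have hval : ∀ y ∈ B, h (removeCoord i y) = y i := fun y hy => by
    rw [← hheq (mem_image_of_mem _ hy)]
    exact hinv2 y hy
  refine ⟨⟨i, h, removeCoord i x, hh⟩, min r 1, by positivity, ?_, fun y hy => ?_⟩
  · simp [GraphPatch.base, GraphPatch.param, hval x hxB]
  · refine ⟨removeCoord i y, ?_, ?_⟩
    · exact (dist_removeCoord_le i y x).trans
        ((Metric.mem_ball.1 hy.2).le.trans (min_le_right _ _))
    · simp [GraphPatch.param, hval y hy]

theorem IsC1Piece.exists_graphPatch_cover {P : Set (RSpace (n + 1))} (hP : IsC1Piece P) :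
    ∃ (t : Finset (RSpace (n + 1))) (p : RSpace (n + 1) → GraphPatch n),
      (∀ x ∈ t, x ∈ closure P ∧ (p x).base = x) ∧
      P ⊆ ⋃ x ∈ t, (p x).param '' Metric.closedBall (p x).center 1 := by
  obtain ⟨M, O, hM, -, hK, hKM, -, hMP, hPK⟩ := hP
  have h : ∀ x, ∃ (p : GraphPatch n) (r : ℝ), x ∈ M → 0 < r ∧ p.base = x ∧
      M ∩ Metric.ball x r ⊆ p.param '' Metric.closedBall p.center 1 := fun x => by
    by_cases hx : x ∈ M
    · obtain ⟨p, r, h⟩ := hM.exists_graphPatch hx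
      exact ⟨p, r, fun _ => h⟩
    -- Dummy patch off `M`, so that the choice is made for every `x`.
    · exact ⟨⟨0, 0, 0, LipschitzWith.const' 0⟩, 0, fun h => absurd h hx⟩
  choose p r hpr using h
  obtain ⟨t, ht, htc⟩ := hK.elim_nhds_subcover (fun x => Metric.ball x (r x))
    fun x hx => Metric.ball_mem_nhds x (hpr x (hKM hx)).1
  refine ⟨t, p, fun x hx => ⟨closure_mono hMP (ht x hx), (hpr x (hKM (ht x hx))).2.1⟩, ?_⟩
  intro y hy
  obtain ⟨x, hx, hyx⟩ := mem_iUnion₂.1 (htc (hPK hy))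
  exact mem_iUnion₂.2 ⟨x, hx, (hpr x (hKM (ht x hx))).2.2 ⟨hKM (hPK hy), hyx⟩⟩

/-- A family of patches of which only finitely many are centred in any given ball. -/
def IsLocallyFiniteFamily {ι : Type*} (p : ι → GraphPatch n) : Prop :=
  ∀ R : ℝ, {k | (p k).base ∈ Metric.closedBall 0 R}.Finite

theorem IsPiecewiseC1Surface.exists_graphPatch_cover {S : Set (RSpace (n + 1))}
    (hS : IsPiecewiseC1Surface S) :
    ∃ (ι : Type) (_ : Countable ι) (p : ι → GraphPatch n), IsLocallyFiniteFamily p ∧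
      S ⊆ ⋃ k, (p k).param '' Metric.closedBall (p k).center 1 := by
  obtain ⟨P, hP, hfin, rfl⟩ := hS
  choose t p htp hcov using fun j => (hP j).exists_graphPatch_cover
  refine ⟨Σ j, t j, inferInstance, fun k => p k.1 k.2, fun R => ?_, ?_⟩
  · have hJ := hfin.closure.finite_nonempty_inter_compact
      (isCompact_closedBall (0 : RSpace (n + 1)) R)
    refine (hJ.biUnion fun j _ => (finite_univ (α := t j)).image (Sigma.mk j)).subset ?_
    rintro ⟨j, x, hx⟩ hk
    refine mem_iUnion₂.2 ⟨j, ⟨x, (htp j x hx).1, ?_⟩, ⟨x, hx⟩, mem_univ _, rfl⟩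
    simpa [(htp j x hx).2] using hk
  · refine iUnion_subset fun j y hy => ?_
    obtain ⟨x, hx, hyx⟩ := mem_iUnion₂.1 (hcov j hy)
    exact mem_iUnion.2 ⟨⟨j, x, hx⟩, hyx⟩

end Cover

/-! ### Test functions and dual norms -/

section Duality

variable {d : ℕ} {V : Opens (RSpace d)}

theorem TestFunction.contDiff_one (g : TestFunction V ℝ ⊤) : ContDiff ℝ 1 g :=
  g.contDiff.of_le (by exact_mod_cast le_top)

theorem TestFunction.continuous_fderiv (g : TestFunction V ℝ ⊤) : Continuous (fderiv ℝ g) :=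
  g.contDiff_one.continuous_fderiv one_ne_zero

theorem TestFunction.integrable_of_isLocallyFinite (g : TestFunction V ℝ ⊤)
    (μ : Measure (RSpace d)) [IsLocallyFiniteMeasure μ] : Integrable g μ :=
  g.continuous.integrable_of_hasCompactSupport g.hasCompactSupport

theorem TestFunction.eq_zero_of_notMem (g : TestFunction V ℝ ⊤) {x : RSpace d} (hx : x ∉ V) :
    g x = 0 :=
  image_eq_zero_of_notMem_tsupport fun h => hx (g.tsupport_subset h)

theorem lintegral_enorm_add_eq_ofReal_w11Norm (g : TestFunction V ℝ ⊤) :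
    (∫⁻ x, ‖g x‖ₑ) + ∫⁻ x, ‖fderiv ℝ g x‖ₑ = ENNReal.ofReal (w11Norm g) := by
  rw [w11Norm, ENNReal.ofReal_add (integral_nonneg fun x => abs_nonneg _)
    (integral_nonneg fun x => norm_nonneg _), ← ofReal_integral_norm_eq_lintegral_enorm
    (g.integrable_of_isLocallyFinite volume), ← ofReal_integral_norm_eq_lintegral_enorm
    (g.continuous_fderiv.integrable_of_hasCompactSupport (g.hasCompactSupport.fderiv ℝ))]
  rfl

/-- The Cauchy–Schwarz inequality on a set of finite volume. -/
theorem setLIntegral_enorm_le_of_integral_sq_le {F : Type*} [NormedAddCommGroup F]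
    {f : RSpace d → F} (hf : Continuous f) (hc : HasCompactSupport f) {T : Set (RSpace d)} {b : ℝ}
    (hb : ∫ x, ‖f x‖ ^ 2 ≤ b ^ 2) (hb0 : 0 ≤ b) :
    ∫⁻ x in T, ‖f x‖ₑ ≤ volume T ^ (1 / 2 : ℝ) * ENNReal.ofReal b := by
  have h := ENNReal.lintegral_mul_le_Lp_mul_Lq (volume.restrict T) Real.HolderConjugate.two_two
    (f := fun _ => 1) (g := fun x => ‖f x‖ₑ) aemeasurable_const (by
      exact hf.enorm.measurable.aemeasurable)
  simp only [Pi.mul_apply, one_mul, ENNReal.one_rpow, lintegral_one,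
    Measure.restrict_apply_univ] at h
  refine h.trans ?_
  gcongr
  have h2 : ∫⁻ x, ‖f x‖ₑ ^ (2 : ℝ) = ENNReal.ofReal (∫ x, ‖f x‖ ^ 2) := by
    rw [ofReal_integral_eq_lintegral_ofReal]
    · refine lintegral_congr fun x => ?_
      rw [← ofReal_norm, ENNReal.ofReal_rpow_of_nonneg (norm_nonneg _) (by norm_num)]
      norm_num
    · have h3 : HasCompactSupport fun x => ‖f x‖ ^ 2 :=
        hc.comp_left (g := fun v : F => ‖v‖ ^ 2) (by simp)
      exact (hf.norm.pow 2).integrable_of_hasCompactSupport h3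
    · exact Eventually.of_forall fun x => by positivity
  calc (∫⁻ x in T, ‖f x‖ₑ ^ (2 : ℝ)) ^ (1 / 2 : ℝ)
      ≤ ENNReal.ofReal (b ^ 2) ^ (1 / 2 : ℝ) := by
        gcongr
        exact (setLIntegral_le_lintegral _ _).trans (h2.le.trans (ENNReal.ofReal_le_ofReal hb))
    _ = ENNReal.ofReal b := by
        rw [ENNReal.ofReal_rpow_of_nonneg (by positivity) (by norm_num), ← Real.sqrt_eq_rpow,
          Real.sqrt_sq hb0]

theorem setLIntegral_enorm_le_of_h1Norm_le (g : TestFunction V ℝ ⊤) (hg : h1Norm g ≤ 1)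
    (T : Set (RSpace d)) : ∫⁻ x in T, ‖g x‖ₑ ≤ volume T ^ (1 / 2 : ℝ) := by
  have h := hg
  rw [h1Norm, Real.sqrt_le_iff, one_pow] at h
  replace h := h.2
  have h0 : 0 ≤ ∫ x, ‖fderiv ℝ g x‖ ^ 2 := integral_nonneg fun x => by positivity
  have h1 := setLIntegral_enorm_le_of_integral_sq_le (T := T) (b := 1) g.continuous
    g.hasCompactSupport (by simp only [Real.norm_eq_abs, sq_abs]; linarith) zero_le_one
  simpa using h1

/-- Applied to a thin tube, the factor `volume T ^ (1 / 2)` gives the rate of convergence in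
`H^{-1}`. -/
theorem setLIntegral_enorm_fderiv_le_of_h1Norm_le (g : TestFunction V ℝ ⊤) (hg : h1Norm g ≤ 1)
    (T : Set (RSpace d)) : ∫⁻ x in T, ‖fderiv ℝ g x‖ₑ ≤ volume T ^ (1 / 2 : ℝ) := by
  have h := hg
  rw [h1Norm, Real.sqrt_le_iff, one_pow] at h
  replace h := h.2
  have h0 : 0 ≤ ∫ x, (g x) ^ 2 := integral_nonneg fun x => by positivity
  have h1 := setLIntegral_enorm_le_of_integral_sq_le (T := T) (b := 1) g.continuous_fderiv
    (g.hasCompactSupport.fderiv ℝ) (by linarith) zero_le_one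
  simpa using h1

theorem lintegral_enorm_add_le_of_h1Norm_le (g : TestFunction V ℝ ⊤) (hg : h1Norm g ≤ 1) :
    (∫⁻ x, ‖g x‖ₑ) + ∫⁻ x, ‖fderiv ℝ g x‖ₑ ≤ 2 * volume (V : Set (RSpace d)) ^ (1 / 2 : ℝ) := by
  rw [← setLIntegral_eq_of_support_subset (s := V) (f := fun x => ‖g x‖ₑ),
    ← setLIntegral_eq_of_support_subset (s := V) (f := fun x => ‖fderiv ℝ g x‖ₑ), two_mul]
  · exact add_le_add (setLIntegral_enorm_le_of_h1Norm_le g hg _)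
      (setLIntegral_enorm_fderiv_le_of_h1Norm_le g hg _)
  · intro x hx
    refine g.tsupport_subset (support_fderiv_subset ℝ fun h => hx ?_)
    simp only [h]
    exact enorm_zero (E := RSpace d →L[ℝ] ℝ)
  · intro x hx
    exact g.tsupport_subset (subset_tsupport _ (enorm_ne_zero.1 hx))

/-- A measure satisfies a `W^{1,1}` trace inequality on every ball. -/
def HasTraceInequality (μ : Measure (RSpace d)) : Prop :=
  ∀ (c : RSpace d) (r : ℝ), ∃ C : ℝ≥0∞, C ≠ ∞ ∧ ∀ g : TestFunction (openBall c r) ℝ ⊤,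
    ∫⁻ x, ‖g x‖ₑ ∂μ ≤ C * ((∫⁻ x, ‖g x‖ₑ) + ∫⁻ x, ‖fderiv ℝ g x‖ₑ)

theorem ofReal_abs_measurePairing_le (μ : Measure (RSpace d)) (g : TestFunction V ℝ ⊤) :
    ENNReal.ofReal |measurePairing μ V g| ≤ ∫⁻ x, ‖g x‖ₑ ∂μ := by
  rw [← Real.norm_eq_abs, ofReal_norm]
  exact enorm_integral_le_lintegral_enorm _

theorem HasTraceInequality.memWNegOneInftyLocPos {μ : Measure (RSpace d)}
    (hμ : IsLocallyFiniteMeasure μ) (h : HasTraceInequality μ) : MemWNegOneInftyLocPos μ := by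
  refine ⟨hμ, fun c r => ?_⟩
  obtain ⟨C, hC, h⟩ := h c r
  refine (iSup₂_le fun g hg => ?_).trans_lt hC.lt_top
  refine (ofReal_abs_measurePairing_le μ g).trans ((h g).trans ?_)
  rw [lintegral_enorm_add_eq_ofReal_w11Norm]
  exact mul_le_of_le_one_right' (ENNReal.ofReal_le_one.2 hg)

/-- A ball has finite volume, so its `H¹₀` norm controls its `W^{1,1}_0` norm. -/
theorem HasTraceInequality.memHNegOneLocPos {μ : Measure (RSpace d)}
    (hμ : IsLocallyFiniteMeasure μ) (h : HasTraceInequality μ) : MemHNegOneLocPos μ := by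
  refine ⟨hμ, fun c r => ?_⟩
  obtain ⟨C, hC, h⟩ := h c r
  have hV : volume (openBall c r : Set (RSpace d)) ≠ ∞ := measure_ball_lt_top.ne
  refine (iSup₂_le fun g hg => ?_).trans_lt
    (ENNReal.mul_lt_top hC.lt_top (b := 2 * volume (openBall c r : Set (RSpace d)) ^ (1 / 2 : ℝ))
      (ENNReal.mul_lt_top (by simp) (ENNReal.rpow_lt_top_of_nonneg (by norm_num) hV)))
  refine (ofReal_abs_measurePairing_le μ g).trans ((h g).trans ?_)
  gcongr
  exact lintegral_enorm_add_le_of_h1Norm_le g hg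

end Duality

/-! ### Locally finite sums of measures carried by patches -/

section Sums

variable {n : ℕ} {ι : Type*} {p : ι → GraphPatch n}

/-- Only finitely many patches matter in a given ball. -/
theorem IsLocallyFiniteFamily.exists_finset (hp : IsLocallyFiniteFamily p)
    (c : RSpace (n + 1)) (r : ℝ) :
    ∃ F : Finset ι, ∀ k ∉ F, Metric.ball c r ⊆
      (Metric.closedBall (p k).base (GraphPatch.radius n))ᶜ := by
  refine ⟨(hp (‖c‖ + r + GraphPatch.radius n)).toFinset, fun k hk x hx hx' => hk ?_⟩
  simp only [Finite.mem_toFinset, mem_ofPred_eq, mem_closedBall_zero_iff]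
  have h1 := norm_sub_le ((p k).base - x) (c - x)
  rw [Metric.mem_ball, dist_eq_norm'] at hx
  rw [Metric.mem_closedBall, dist_eq_norm'] at hx'
  have h2 : (p k).base = ((p k).base - x) - (c - x) + c := by abel
  have h3 := norm_add_le (((p k).base - x) - (c - x)) c
  rw [← h2] at h3
  linarith

/-- `F` depends on the patches and the ball only, not on `ρ`; the layers for all δ ≤ 1 and their
limit can thus share one finite set. -/
theorem IsLocallyFiniteFamily.exists_finset_restrict (hp : IsLocallyFiniteFamily p)
    (c : RSpace (n + 1)) (r : ℝ) :
    ∃ F : Finset ι, ∀ ρ : ι → Measure (RSpace (n + 1)),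
      (∀ k, ρ k (Metric.closedBall (p k).base (GraphPatch.radius n))ᶜ = 0) →
      (Measure.sum ρ).restrict (Metric.ball c r) = ∑ k ∈ F, (ρ k).restrict (Metric.ball c r) := by
  obtain ⟨F, hF⟩ := hp.exists_finset c r
  refine ⟨F, fun ρ hρ => ?_⟩
  ext B hB
  rw [Measure.restrict_apply hB, Measure.sum_apply _ (hB.inter Metric.isOpen_ball.measurableSet),
    Measure.finsetSum_apply, tsum_eq_sum (s := F)]
  · exact Finset.sum_congr rfl fun k _ => (Measure.restrict_apply hB).symm
  · exact fun k hk => measure_mono_null (inter_subset_right.trans (hF k hk)) (hρ k)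

theorem IsLocallyFiniteFamily.isLocallyFiniteMeasure_sum (hp : IsLocallyFiniteFamily p)
    {ρ : ι → Measure (RSpace (n + 1))} [∀ k, IsFiniteMeasure (ρ k)]
    (hρ : ∀ k, ρ k (Metric.closedBall (p k).base (GraphPatch.radius n))ᶜ = 0) :
    IsLocallyFiniteMeasure (Measure.sum ρ) := by
  refine ⟨fun x => ⟨Metric.ball x 1, Metric.ball_mem_nhds x one_pos, ?_⟩⟩
  obtain ⟨F, hF⟩ := hp.exists_finset_restrict x 1
  rw [← Measure.restrict_apply_univ, hF ρ hρ, Measure.finsetSum_apply]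
  exact ENNReal.sum_lt_top.2 fun k _ => measure_lt_top _ _

theorem IsLocallyFiniteFamily.hasTraceInequality_sum (hp : IsLocallyFiniteFamily p)
    {ρ : ι → Measure (RSpace (n + 1))}
    (hρ : ∀ k, ρ k (Metric.closedBall (p k).base (GraphPatch.radius n))ᶜ = 0)
    {C : ℝ≥0∞} (hC : C ≠ ∞)
    (h : ∀ k (g : RSpace (n + 1) → ℝ), ContDiff ℝ 1 g → HasCompactSupport g →
      ∫⁻ x, ‖g x‖ₑ ∂ρ k ≤ C * ((∫⁻ x, ‖g x‖ₑ) + ∫⁻ x, ‖fderiv ℝ g x‖ₑ)) :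
    HasTraceInequality (Measure.sum ρ) := by
  intro c r
  obtain ⟨F, hF⟩ := hp.exists_finset_restrict c r
  refine ⟨F.card * C, ENNReal.mul_ne_top (by simp) hC, fun g => ?_⟩
  rw [← setLIntegral_eq_of_support_subset (s := Metric.ball c r) (f := fun x => ‖g x‖ₑ), hF ρ hρ,
    lintegral_finsetSum_measure, mul_assoc, ← nsmul_eq_mul]
  · refine Finset.sum_le_card_nsmul _ _ _ fun k _ => ?_
    exact (setLIntegral_le_lintegral _ _).trans (h k g g.contDiff_one g.hasCompactSupport)
  · intro x hx
    exact g.tsupport_subset (subset_tsupport _ (enorm_ne_zero.1 hx))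

theorem IsLocallyFiniteFamily.exists_finset_measurePairing (hp : IsLocallyFiniteFamily p)
    (c : RSpace (n + 1)) (r : ℝ) :
    ∃ F : Finset ι, ∀ ρ : ι → Measure (RSpace (n + 1)), (∀ k, IsFiniteMeasure (ρ k)) →
      (∀ k, ρ k (Metric.closedBall (p k).base (GraphPatch.radius n))ᶜ = 0) →
      ∀ g : TestFunction (openBall c r) ℝ ⊤,
        measurePairing (Measure.sum ρ) (openBall c r) g =
          ∑ k ∈ F, measurePairing (ρ k) (openBall c r) g := by
  obtain ⟨F, hF⟩ := hp.exists_finset_restrict c r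
  refine ⟨F, fun ρ hfin hρ g => ?_⟩
  have h : ∀ ν : Measure (RSpace (n + 1)), measurePairing ν (openBall c r) g =
      ∫ x in Metric.ball c r, g x ∂ν := fun ν =>
    (setIntegral_eq_integral_of_forall_compl_eq_zero fun x hx => g.eq_zero_of_notMem hx).symm
  rw [h, hF ρ hρ, integral_finsetSum_measure]
  · exact Finset.sum_congr rfl fun k _ => (h _).symm
  · exact fun k _ => g.integrable_of_isLocallyFinite _

end Sums

/-! ### The dominating measures and their limit -/

section Layers

variable {n : ℕ}

/-- The uniform measure on a tube, with density `a / δ`. -/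
noncomputable def GraphPatch.layer (p : GraphPatch n) (a δ : ℝ) : Measure (RSpace (n + 1)) :=
  ENNReal.ofReal (a / δ) • volume.restrict (p.tube δ)

/-- The limit of the measures `p.layer a δ` as `δ` tends to zero. -/
noncomputable def GraphPatch.limitLayer (p : GraphPatch n) (a : ℝ) : Measure (RSpace (n + 1)) :=
  ENNReal.ofReal (2 * a) • p.liftedMeasure 2

namespace GraphPatch

variable (p : GraphPatch n)

instance (a δ : ℝ) : IsFiniteMeasure (p.layer a δ) := by
  have := Measure.smul_finite (volume.restrict (p.tube δ))
    (ENNReal.ofReal_ne_top (r := a / δ))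
  unfold layer; infer_instance

instance (a : ℝ) : IsFiniteMeasure (p.limitLayer a) := by
  have := Measure.smul_finite (p.liftedMeasure 2) (ENNReal.ofReal_ne_top (r := 2 * a))
  unfold limitLayer; infer_instance

theorem layer_compl_closedBall (a : ℝ) {δ : ℝ} (hδ : δ ≤ 1) :
    p.layer a δ (Metric.closedBall p.base (radius n))ᶜ = 0 := by
  rw [layer, Measure.smul_apply, Measure.restrict_apply
    Metric.isClosed_closedBall.measurableSet.compl, inter_comm,
    (disjoint_compl_right_iff_subset.2 (p.tube_subset_closedBall hδ)).inter_eq]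
  simp

theorem limitLayer_compl_closedBall (a : ℝ) :
    p.limitLayer a (Metric.closedBall p.base (radius n))ᶜ = 0 := by
  rw [limitLayer, Measure.smul_apply, p.liftedMeasure_compl_closedBall le_rfl, smul_zero]

/-- The fibre length 2δ cancels the density `a / δ`. -/
theorem limitLayer_eq_map {a δ : ℝ} (hδ : 0 < δ) (ha : 0 ≤ a) :
    p.limitLayer a = (p.layer a δ).map p.proj := by
  rw [layer, Measure.map_smul, p.map_proj_restrict_tube, smul_smul,
    ← ENNReal.ofReal_mul (by positivity), limitLayer]
  congr 2
  field_simp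

theorem enorm_measurePairing_sub_le {V : Opens (RSpace (n + 1))} {a δ : ℝ} (hδ : 0 < δ)
    (ha : 0 ≤ a) (g : TestFunction V ℝ ⊤) (hg : h1Norm g ≤ 1) :
    ‖measurePairing (p.layer a δ) V g - measurePairing (p.limitLayer a) V g‖ₑ ≤
      ENNReal.ofReal (2 * a) * (ENNReal.ofReal (2 * δ) * 4 ^ n) ^ (1 / 2 : ℝ) := by
  have hi : Integrable (fun x => g (p.proj x)) (p.layer a δ) := by
    have h := g.integrable_of_isLocallyFinite ((p.layer a δ).map p.proj)
    exact h.comp_measurable p.continuous_proj.measurable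
  rw [measurePairing, measurePairing, p.limitLayer_eq_map hδ ha,
    integral_map p.continuous_proj.measurable.aemeasurable
      g.continuous.aestronglyMeasurable,
    ← integral_sub (g.integrable_of_isLocallyFinite _) hi]
  refine (enorm_integral_le_lintegral_enorm _).trans ?_
  rw [layer, lintegral_smul_measure, smul_eq_mul]
  calc ENNReal.ofReal (a / δ) * ∫⁻ x in p.tube δ, ‖g x - g (p.proj x)‖ₑ
      ≤ ENNReal.ofReal (a / δ) * (ENNReal.ofReal (2 * δ) *
          (ENNReal.ofReal (2 * δ) * 4 ^ n) ^ (1 / 2 : ℝ)) := by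
        gcongr
        refine (p.lintegral_enorm_sub_proj_le δ g.contDiff_one).trans ?_
        gcongr
        refine (setLIntegral_enorm_fderiv_le_of_h1Norm_le g hg _).trans ?_
        gcongr
        exact p.volume_tube_le δ
    _ = _ := by
        rw [← mul_assoc, ← ENNReal.ofReal_mul (by positivity)]
        congr 2
        field_simp

end GraphPatch

variable {ι : Type*} {p : ι → GraphPatch n}

theorem IsLocallyFiniteFamily.memHNegOneLocPos_sum_layer (hp : IsLocallyFiniteFamily p) (a : ℝ)
    {δ : ℝ} (hδ : δ ≤ 1) : MemHNegOneLocPos (Measure.sum fun k => (p k).layer a δ) := by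
  refine HasTraceInequality.memHNegOneLocPos
    (hp.isLocallyFiniteMeasure_sum fun k => (p k).layer_compl_closedBall a hδ)
    (hp.hasTraceInequality_sum (fun k => (p k).layer_compl_closedBall a hδ)
      (ENNReal.ofReal_ne_top (r := a / δ)) fun k g _ _ => ?_)
  -- The constant `a / δ` blows up as δ → 0, which is harmless: only membership for each fixed δ is
  -- claimed.
  rw [GraphPatch.layer, lintegral_smul_measure, smul_eq_mul]
  gcongr
  exact (setLIntegral_le_lintegral _ _).trans le_self_add

theorem IsLocallyFiniteFamily.memHNegOneLocPos_sum_limitLayer (hp : IsLocallyFiniteFamily p)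
    (a : ℝ) : MemHNegOneLocPos (Measure.sum fun k => (p k).limitLayer a) := by
  refine HasTraceInequality.memHNegOneLocPos
    (hp.isLocallyFiniteMeasure_sum fun k => (p k).limitLayer_compl_closedBall a)
    (hp.hasTraceInequality_sum (fun k => (p k).limitLayer_compl_closedBall a)
      (ENNReal.ofReal_ne_top (r := 2 * a)) fun k g hg hc => ?_)
  rw [GraphPatch.limitLayer, lintegral_smul_measure, smul_eq_mul]
  gcongr
  exact ((p k).lintegral_enorm_liftedMeasure_le 2 hg hc).trans le_add_self

theorem IsLocallyFiniteFamily.tendsto_hNegOneNorm_layer (hp : IsLocallyFiniteFamily p) {a : ℝ}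
    (ha : 0 ≤ a) (c : RSpace (n + 1)) (r : ℝ) :
    Tendsto (fun δ : ℝ => hNegOneNorm (fun g =>
      measurePairing (Measure.sum fun k => (p k).layer a δ) (openBall c r) g -
        measurePairing (Measure.sum fun k => (p k).limitLayer a) (openBall c r) g))
      (𝓝[>] 0) (𝓝 0) := by
  obtain ⟨F, hF⟩ := hp.exists_finset_measurePairing c r
  have hlim : Tendsto (fun δ : ℝ => (F.card : ℝ≥0∞) *
      (ENNReal.ofReal (2 * a) * (ENNReal.ofReal (2 * δ) * 4 ^ n) ^ (1 / 2 : ℝ)))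
      (𝓝[>] 0) (𝓝 0) := by
    have h1 : Tendsto (fun δ : ℝ => ENNReal.ofReal (2 * δ)) (𝓝[>] 0) (𝓝 0) := by
      have : Tendsto (fun δ : ℝ => ENNReal.ofReal (2 * δ)) (𝓝 0) (𝓝 (ENNReal.ofReal (2 * 0))) :=
        (ENNReal.continuous_ofReal.comp (continuous_const.mul continuous_id)).tendsto 0
      simpa using this.mono_left nhdsWithin_le_nhds
    have h2 := ENNReal.Tendsto.mul_const (b := (4 : ℝ≥0∞) ^ n) h1 (Or.inr (by simp))
    have h3 := (ENNReal.continuous_rpow_const (y := (1 / 2 : ℝ))).tendsto _ |>.comp h2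
    have h4 := ENNReal.Tendsto.const_mul (a := (F.card : ℝ≥0∞)) (ENNReal.Tendsto.const_mul
      (a := ENNReal.ofReal (2 * a)) h3 (Or.inr ENNReal.ofReal_ne_top)) (Or.inr (by simp))
    simpa using h4
  refine tendsto_of_tendsto_of_tendsto_of_le_of_le' tendsto_const_nhds hlim
    (Eventually.of_forall fun _ => zero_le) ?_
  filter_upwards [Ioc_mem_nhdsGT one_pos] with δ hδ
  refine iSup₂_le fun g hg => ?_
  beta_reduce
  rw [hF _ (fun k => inferInstance) (fun k => (p k).layer_compl_closedBall a hδ.2),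
    hF _ (fun k => inferInstance) (fun k => (p k).limitLayer_compl_closedBall a),
    ← Finset.sum_sub_distrib, ← Real.norm_eq_abs, ofReal_norm, ← nsmul_eq_mul]
  refine (enorm_sum_le _ _).trans (Finset.sum_le_card_nsmul _ _ _ fun k _ => ?_)
  exact (p k).enorm_measurePairing_sub_le hδ.1 ha g hg

end Layers

/-! ### Surface measures and tile averages -/

section Tiles

variable {n : ℕ}

/-- The constant comparing surface measure and Lebesgue measure on a patch. -/
noncomputable def surfaceConst (n : ℕ) : NNReal :=
  Measure.addHaarScalarFactor (volume : Measure (EuclideanSpace ℝ (Fin n)))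
    (Measure.hausdorffMeasure n) * (euclideanConst (n + 1) * (2 * n + 1)) ^ n

variable {ι : Type*} {p : ι → GraphPatch n}

theorem surfaceMeasure_le_sum [Countable ι] {S : Set (RSpace (n + 1))}
    (hS : S ⊆ ⋃ k, (p k).param '' Metric.closedBall (p k).center 1) :
    surfaceMeasure S ≤ Measure.sum fun k => (surfaceConst n : ℝ≥0∞) • (p k).liftedMeasure 1 := by
  refine Measure.le_iff.2 fun B hB => ?_
  rw [surfaceMeasure, Measure.restrict_apply hB, Measure.sum_apply _ hB, Nat.add_sub_cancel]
  calc Measure.euclideanHausdorffMeasure n (B ∩ S)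
      ≤ Measure.euclideanHausdorffMeasure n
          (⋃ k, B ∩ (p k).param '' Metric.closedBall (p k).center 1) := by
        rw [← inter_iUnion]
        exact measure_mono (inter_subset_inter_right _ hS)
    _ ≤ _ := measure_iUnion_le _
    _ ≤ _ := ENNReal.tsum_le_tsum fun k => by
        exact (p k).euclideanHausdorffMeasure_inter_image_le 1 hB

theorem IsLocallyFiniteFamily.memWNegOneInftyLocPos_of_le (hp : IsLocallyFiniteFamily p)
    {μ : Measure (RSpace (n + 1))} {C : NNReal}
    (hμ : μ ≤ Measure.sum fun k => (C : ℝ≥0∞) • (p k).liftedMeasure 1) :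
    MemWNegOneInftyLocPos μ := by
  have hρ : ∀ k, ((C : ℝ≥0∞) • (p k).liftedMeasure 1)
      (Metric.closedBall (p k).base (GraphPatch.radius n))ᶜ = 0 := fun k => by
    rw [Measure.smul_apply, (p k).liftedMeasure_compl_closedBall one_le_two, smul_zero]
  have hfin : ∀ k, IsFiniteMeasure ((C : ℝ≥0∞) • (p k).liftedMeasure 1) := fun k =>
    Measure.smul_finite _ ENNReal.coe_ne_top
  refine HasTraceInequality.memWNegOneInftyLocPos ?_ fun c r => ?_
  · have := hp.isLocallyFiniteMeasure_sum hρ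
    exact Measure.isLocallyFiniteMeasure_of_le hμ
  · obtain ⟨K, hK, h⟩ := hp.hasTraceInequality_sum hρ (C := C) ENNReal.coe_ne_top
      (fun k g hg hc => by
        rw [lintegral_smul_measure, smul_eq_mul]
        gcongr
        exact ((p k).lintegral_enorm_liftedMeasure_le 1 hg hc).trans le_add_self) c r
    exact ⟨K, hK, fun g => (lintegral_mono' hμ le_rfl).trans (h g)⟩

-- For the tiles: countably many null translates could not cover the space, so |A| > 0, and
-- disjointness leaves one term of the tile average at each point.
variable {A Λ : Set (RSpace (n + 1))}

theorem IsTiling.volume_pos (hA : IsTiling A Λ) : 0 < volume A := by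
  by_contra h
  have h0 : volume A = 0 := by simpa using h
  have h1 : volume (⋃ i ∈ Λ, (i +ᵥ A)) = 0 :=
    (measure_biUnion_null_iff hA.countable).2 fun i _ => by rw [measure_vadd, h0]
  rw [hA.cover] at h1
  exact isOpen_univ.measure_ne_zero volume univ_nonempty h1

theorem dist_le_of_mem_scaledTile {R ε : ℝ} (hR : ∀ x ∈ A, ∀ y ∈ A, dist x y ≤ R) (hε : 0 ≤ ε)
    {i x y : RSpace (n + 1)} (hx : x ∈ scaledTile A ε i) (hy : y ∈ scaledTile A ε i) :
    dist x y ≤ ε * R := by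
  obtain ⟨_, ⟨a, ha, rfl⟩, rfl⟩ := hx
  obtain ⟨_, ⟨b, hb, rfl⟩, rfl⟩ := hy
  simp only [dist_smul₀, Real.norm_eq_abs, abs_of_nonneg hε, vadd_eq_add, dist_add_left]
  exact mul_le_mul_of_nonneg_left (hR a ha b hb) hε

theorem volume_scaledTile {ε : ℝ} (hε : 0 ≤ ε) (i : RSpace (n + 1)) :
    volume (scaledTile A ε i) = ENNReal.ofReal (ε ^ (n + 1)) * volume A := by
  rw [scaledTile, Measure.addHaar_smul, measure_vadd, finrank_euclideanSpace_fin,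
    abs_of_nonneg (by positivity)]

theorem IsTiling.tileAverage_apply (hA : IsTiling A Λ) (μ : Measure (RSpace (n + 1))) {ε : ℝ}
    (hε : 0 < ε) (x : RSpace (n + 1)) :
    ∃ i ∈ Λ, x ∈ scaledTile A ε i ∧
      tileAverage A Λ μ ε x = μ (scaledTile A ε i) / volume (scaledTile A ε i) := by
  have hmem : ∀ i, x ∈ scaledTile A ε i ↔ ε⁻¹ • x ∈ i +ᵥ A := fun i =>
    mem_smul_set_iff_inv_smul_mem₀ hε.ne' _ _
  have hx : ε⁻¹ • x ∈ ⋃ i ∈ Λ, (i +ᵥ A) := hA.cover ▸ mem_univ _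
  obtain ⟨i, hi, hxi⟩ := mem_iUnion₂.1 hx
  refine ⟨i, hi, (hmem i).2 hxi, ?_⟩
  rw [tileAverage, tsum_eq_single ⟨i, hi⟩, indicator_of_mem ((hmem i).2 hxi)]
  rintro ⟨j, hj⟩ hji
  refine indicator_of_notMem (fun h => ?_) _
  refine (disjoint_left.1 (hA.disjoint hj hi fun h => hji (Subtype.ext h)) ?_ hxi)
  exact (hmem j).1 h

/-- The part of a patch in a tile of diameter at most `ρ` is seen from the tile through the tube. -/
theorem GraphPatch.liftedMeasure_le_indicator_tube (p : GraphPatch n) {T : Set (RSpace (n + 1))}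
    (hT : MeasurableSet T) {ρ : ℝ} (hTρ : ∀ x ∈ T, ∀ y ∈ T, dist x y ≤ ρ) (hρ1 : ρ ≤ 1)
    {x : RSpace (n + 1)} (hx : x ∈ T) :
    p.liftedMeasure 1 T ≤ (p.tube ((2 * n + 2) * ρ)).indicator
      (fun _ => ENNReal.ofReal ((2 * ρ) ^ n)) x := by
  rw [p.liftedMeasure_apply 1 hT]
  rcases (p.param ⁻¹' T ∩ Metric.closedBall p.center 1).eq_empty_or_nonempty with h | ⟨y, hyT, hy⟩
  · rw [h, measure_empty]; exact zero_le
  have hd : dist (removeCoord p.dir x) y ≤ ρ := by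
    have := dist_removeCoord_le p.dir x (p.param y)
    rw [param, removeCoord_insertCoord] at this
    exact this.trans (hTρ _ hx _ hyT)
  -- Moving from the patch point over `y` to `x` costs ρ vertically, plus `(2 * n + 1) * ρ` from the
  -- slope. The tube's base radius 2 leaves room for the horizontal shift ρ ≤ 1 from the radius 1.
  have hxt : x ∈ p.tube ((2 * n + 2) * ρ) := by
    refine ⟨?_, ?_⟩
    · rw [Metric.mem_closedBall] at hy ⊢
      linarith [dist_triangle (removeCoord p.dir x) y p.center]
    · have h1 := (abs_apply_sub_le_dist x (p.param y) p.dir).trans (hTρ _ hx _ hyT)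
      rw [param, insertCoord_apply_same] at h1
      have h2 := p.abs_height_sub_le y (removeCoord p.dir x)
      rw [dist_comm] at h2
      have h3 := abs_sub_le (x p.dir) (p.height y) (p.height (removeCoord p.dir x))
      nlinarith [(Nat.cast_nonneg n : (0 : ℝ) ≤ n)]
  have hρ0 : 0 ≤ ρ := dist_nonneg.trans hd
  rw [indicator_of_mem hxt]
  refine (measure_mono (t := Metric.closedBall y ρ) fun z hz => ?_).trans ?_
  · have := dist_removeCoord_le p.dir (p.param z) (p.param y)
    simp only [param, removeCoord_insertCoord] at this
    exact this.trans (hTρ _ hz.1 _ hyT)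
  · rw [Real.volume_pi_closedBall _ hρ0, Fintype.card_fin]

theorem sum_layer_eq_withDensity [Countable ι] (p : ι → GraphPatch n) (a δ : ℝ) :
    Measure.sum (fun k => (p k).layer a δ) = volume.withDensity
      (∑' k, ((p k).tube δ).indicator fun _ => ENNReal.ofReal (a / δ)) := by
  rw [withDensity_tsum fun k => measurable_const.indicator ((p k).isClosed_tube δ).measurableSet]
  congr 1 with k : 1
  rw [withDensity_indicator ((p k).isClosed_tube δ).measurableSet, withDensity_const]
  rfl

/-- Tile averages are dominated by uniform measures on tubes. -/
theorem IsTiling.withDensity_tileAverage_le [Countable ι] (hA : IsTiling A Λ)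
    {μ : Measure (RSpace (n + 1))}
    {C : NNReal} (hμ : μ ≤ Measure.sum fun k => (C : ℝ≥0∞) • (p k).liftedMeasure 1)
    {R ε : ℝ} (hR0 : 0 < R) (hR : ∀ x ∈ A, ∀ y ∈ A, dist x y ≤ R) (hε : 0 < ε)
    (hεR : ε * R ≤ 1) :
    volume.withDensity (tileAverage A Λ μ ε) ≤ Measure.sum fun k => (p k).layer
      (C * (2 * R) ^ n / (volume A).toReal * ((2 * n + 2) * R)) ((2 * n + 2) * (ε * R)) := by
  have hvtop : volume A ≠ ∞ := hA.isBounded.measure_lt_top.ne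
  have hv : 0 < (volume A).toReal := ENNReal.toReal_pos hA.volume_pos.ne' hvtop
  rw [sum_layer_eq_withDensity]
  refine withDensity_mono (Eventually.of_forall fun x => ?_)
  obtain ⟨i, hi, hxi, hval⟩ := hA.tileAverage_apply μ hε x
  have hT : MeasurableSet (scaledTile A ε i) := (hA.measurableSet.const_vadd i).const_smul₀ ε
  rw [hval, ENNReal.tsum_apply]
  have h1 := hμ (scaledTile A ε i)
  rw [Measure.sum_apply _ hT] at h1
  refine (ENNReal.div_le_div_right h1 _).trans ?_
  rw [ENNReal.div_eq_inv_mul, ← ENNReal.tsum_mul_left]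
  refine ENNReal.tsum_le_tsum fun k => ?_
  have h2 := (p k).liftedMeasure_le_indicator_tube hT
    (fun x hx y hy => dist_le_of_mem_scaledTile hR hε.le hx hy) hεR hxi
  rw [Measure.smul_apply, smul_eq_mul, volume_scaledTile hε.le, ← ENNReal.ofReal_toReal hvtop,
    ← ENNReal.ofReal_mul (by positivity), ← ENNReal.ofReal_inv_of_pos (by positivity),
    ← ENNReal.ofReal_coe_nnreal, ENNReal.toReal_ofReal hv.le]
  -- On the tube both sides equal `C (2R)^n / (ε |A|)`: the constant `a` in the statement is this
  -- density times the half-height `(2 * n + 2) * (ε * R)`, hence free of ε.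
  refine (mul_le_mul_right (mul_le_mul_right h2 _) _).trans (le_of_eq ?_)
  by_cases hx : x ∈ (p k).tube ((2 * n + 2) * (ε * R))
  · rw [indicator_of_mem hx, indicator_of_mem hx, ← ENNReal.ofReal_mul (by positivity),
      ← ENNReal.ofReal_mul (by positivity)]
    congr 1
    field_simp
    rw [mul_pow, mul_pow, mul_pow]
    ring
  · rw [indicator_of_notMem hx, indicator_of_notMem hx, mul_zero, mul_zero]

end Tiles

theorem mainTheorem5 (d : ℕ) (hd : 3 ≤ d) (A Λ : Set (RSpace d)) (hA : IsTiling A Λ)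
    (S : Set (RSpace d)) (hS : IsPiecewiseC1Surface S) :
    IsAdmissible A Λ (surfaceMeasure S) := by
  obtain ⟨n, rfl⟩ : ∃ n, d = n + 1 := ⟨d - 1, by omega⟩
  obtain ⟨ι, _, p, hp, hcov⟩ := hS.exists_graphPatch_cover
  have hμ := surfaceMeasure_le_sum hcov
  refine ⟨hp.memWNegOneInftyLocPos_of_le hμ, ?_⟩
  obtain ⟨R, hR0, hR⟩ : ∃ R : ℝ, 0 < R ∧ ∀ x ∈ A, ∀ y ∈ A, dist x y ≤ R := by
    obtain ⟨R, hR⟩ := Metric.isBounded_iff.1 hA.isBounded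
    exact ⟨max R 1, by positivity, fun x hx y hy => (hR hx hy).trans (le_max_left _ _)⟩
  set a := surfaceConst n * (2 * R) ^ n / (volume A).toReal * ((2 * n + 2) * R)
  have hb : 0 < (2 * n + 2) * R := by positivity
  -- The cap at 1 keeps the tubes locally finite, so that `ν^ε` lies in `H^{-1}_loc` for every ε; it
  -- is inactive for small ε.
  refine ⟨fun ε => Measure.sum fun k => (p k).layer a (min ((2 * n + 2) * (ε * R)) 1),
    Measure.sum fun k => (p k).limitLayer a,
    fun ε _ => hp.memHNegOneLocPos_sum_layer a (min_le_right _ _),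
    hp.memHNegOneLocPos_sum_limitLayer a, fun c r => ?_, ?_⟩
  · refine (hp.tendsto_hNegOneNorm_layer (a := a) (by positivity) c r).comp ?_
    refine tendsto_nhdsWithin_iff.2 ⟨?_, ?_⟩
    · have h : Continuous fun ε : ℝ => min ((2 * n + 2) * (ε * R)) 1 := by fun_prop
      have h' := (h.tendsto 0).mono_left (nhdsWithin_le_nhds (s := Ioi 0))
      simpa using h'
    · filter_upwards [self_mem_nhdsWithin] with ε hε
      have hε0 : 0 < ε := hε
      have h1 : 0 < (2 * n + 2) * (ε * R) := by positivity
      exact mem_Ioi.2 (lt_min h1 one_pos)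
  · filter_upwards [Ioc_mem_nhdsGT (inv_pos.2 hb)] with ε hε
    have h1 : (2 * n + 2) * (ε * R) ≤ 1 := by
      calc (2 * n + 2) * (ε * R) = ε * ((2 * n + 2) * R) := by ring
        _ ≤ ((2 * n + 2) * R)⁻¹ * ((2 * n + 2) * R) := by gcongr; exact hε.2
        _ = 1 := inv_mul_cancel₀ hb.ne'
    have h2 : 0 < ε * R := mul_pos hε.1 hR0
    have h3 : ε * R ≤ 1 := by nlinarith [(Nat.cast_nonneg n : (0 : ℝ) ≤ n)]
    rw [min_eq_left h1]
    exact hA.withDensity_tileAverage_le hμ hR0 hR hε.1 h3
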